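/- Let $d\ge 2$ be an integer and let $\tau$ be a real number with $1/d<\tau\le 1$. Let $\mathrm{Diff}^{1+\tau}_+([0,1])$ denote the group of orientation-preserving $C^1$ diffeomorphisms $f$ of the closed interval $[0,1]$ whose derivative is $\tau$-Hölder continuous on $[0,1]$, that is, for which there is a constant $C<\infty$ with $|f'(x)-f'(y)|\le C|x-y|^{\tau}$ for all $x,y\in[0,1]$ (for $\tau=1$: $f'$ is Lipschitz). Let $\Gamma$ be a subgroup of $\mathrm{Diff}^{1+\tau}_+([0,1])$ isomorphic to $\mathbb{Z}^d$ whose action on the open interval $]0,1[$ is free, that is, no element of $\Gamma$ other than the identity has a fixed point in $]0,1[$. Then the action of $\Gamma$ on $]0,1[$ is minimal, that is, the $\Gamma$-orbit of every point of $]0,1[$ is dense in $]0,1[$; moreover, it is topologically conjugate to an action by translations of the real line, that is, there are a homeomorphism $\varphi:\;]0,1[\;\to\mathbb{R}$ and a group homomorphism $T:\Gamma\to(\mathbb{R},+)$ such that $\varphi(g(x))=\varphi(x)+T(g)$ for all $g\in\Gamma$ and all $x\in\;]0,1[$. -/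

import Mathlib

open scoped unitInterval

/-- `Homeo₊([0,1])`: the group (under composition) of orientation-preserving homeomorphisms
of `[0,1]`. -/
def HomeoPlus : Subgroup (I ≃ₜ I) where
  carrier := {f | StrictMono f}
  one_mem' := strictMono_id
  mul_mem' := fun {_ _} hf hg => hf.comp hg
  inv_mem' := by
    intro f hf x y hxy
    by_contra h
    have h' : f (f.symm y) ≤ f (f.symm x) := hf.monotone (not_lt.mp h)
    simp only [Homeomorph.apply_symm_apply] at h'
    exact absurd hxy (not_lt.mpr h')

namespace HomeoPlus

theorem map_zero (f : HomeoPlus) : f.1 0 = 0 := by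
  apply le_antisymm _ unitInterval.nonneg'
  have h : f.1 0 ≤ f.1 (f.1.symm 0) := f.2.monotone unitInterval.nonneg'
  simpa using h

theorem map_one (f : HomeoPlus) : f.1 1 = 1 := by
  apply le_antisymm unitInterval.le_one'
  have h : f.1 (f.1.symm 1) ≤ f.1 1 := f.2.monotone unitInterval.le_one'
  simpa using h

theorem map_mem_Ioo (f : HomeoPlus) {x : I} (hx : x ∈ Set.Ioo (0 : I) 1) :
    f.1 x ∈ Set.Ioo (0 : I) 1 :=
  ⟨(map_zero f).symm.trans_lt (f.2 hx.1), (f.2 hx.2).trans_eq (map_one f)⟩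

/-- Orientation-preserving homeomorphisms of `[0,1]` fix the endpoints; this is the restriction
of their action to the open interval `]0,1[`. -/
instance : MulAction HomeoPlus (Set.Ioo (0 : I) 1) where
  smul f x := ⟨f.1 x.1, map_mem_Ioo f x.2⟩
  one_smul _ := rfl
  mul_smul _ _ _ := rfl

/-- A homeomorphism of `[0,1]` as a real function: it is `f` on `[0,1]` (and is extended by
constants outside `[0,1]`, where its values are never used). -/
noncomputable def toReal (f : HomeoPlus) : ℝ → ℝ :=
  Set.IccExtend (zero_le_one (α := ℝ)) (fun x : I => (f.1 x : ℝ))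

/-- `f ∈ Diff₊^{1+τ}([0,1])`: `f` is an orientation-preserving `C¹` diffeomorphism of `[0,1]`
(`f` and `f⁻¹` are `C¹` on the closed interval, with one-sided derivatives at the endpoints),
and its derivative is `τ`-Hölder continuous on `[0,1]`. -/
structure IsDiffeoHolder (τ : ℝ) (f : HomeoPlus) : Prop where
  contDiffOn : ContDiffOn ℝ 1 (toReal f) (Set.Icc 0 1)
  contDiffOn_inv : ContDiffOn ℝ 1 (toReal f⁻¹) (Set.Icc 0 1)
  holder : ∃ C : ℝ, ∀ x ∈ Set.Icc (0 : ℝ) 1, ∀ y ∈ Set.Icc (0 : ℝ) 1,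
    |derivWithin (toReal f) (Set.Icc 0 1) x - derivWithin (toReal f) (Set.Icc 0 1) y|
      ≤ C * |x - y| ^ τ

/-- The action of `Γ` on `]0,1[` is free. -/
def ActsFreely (Γ : Subgroup HomeoPlus) : Prop :=
  ∀ g : Γ, ∀ x : Set.Ioo (0 : I) 1, g • x = x → g = 1

/-- The action of `Γ` on `]0,1[` is topologically conjugate, by a homeomorphism
`φ : ]0,1[ → ℝ`, to an action of `Γ` on `ℝ` by translations `y ↦ y + T g`. -/
def ConjugateToTranslations (Γ : Subgroup HomeoPlus) : Prop :=
  ∃ (φ : Set.Ioo (0 : I) 1 ≃ₜ ℝ) (T : Γ →* Multiplicative ℝ),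
    ∀ (g : Γ) (x : Set.Ioo (0 : I) 1), φ (g • x) = φ x + (T g).toAdd

end HomeoPlus

/-!
Ordering `Γ` along an orbit embeds it into the translations of the line (Hölder), with dense image
since `Γ` is not cyclic. Hence the action is minimal, and conjugate to this translation action,
unless there is a wandering interval `J = [x, b]`, that is, one whose images do not overlap.

Suppose there is one, taken maximal, and let `J' = [b, b']` be an adjacent interval. On `Γ ≅ ℤᵈ`
consider the function `g ↦ log (|g J'| / |g J|)`. Hölder continuity of the derivatives of the
generators bounds its variation from `g` to a neighbour by `C |g J| ^ τ`, as long as it is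
negative. Since `∑ |g J| ≤ 1`, this gradient lies in `ℓᵖ` with `p = 1 / τ < d`, so the discrete
Morrey inequality bounds the oscillation by a constant independent of `J'`. Thus if `J'` is short
compared to `J`, then `|g J'| < |g J|` for all `g`. But the maximality of `J` gives a `g` with
`b ≤ g x` and `g b` as close to `b` as desired: then `|g J|` is small, whereas `g b' > b'` forces
`|g J'|` to be nearly as large as `|J'|`.
-/

section IncreasingActions

variable {G X : Type*} [Group G] [MulAction G X]

section LinearOrder

variable [LinearOrder X] [CovariantClass G X HSMul.hSMul LE.le]

theorem smul_le_smul_left_iff (g : G) {x y : X} : g • x ≤ g • y ↔ x ≤ y :=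
  ⟨fun h => by simpa only [inv_smul_smul] using smul_le_smul_left g⁻¹ h, smul_le_smul_left g⟩

theorem smul_lt_smul_left_iff (g : G) {x y : X} : g • x < g • y ↔ x < y :=
  lt_iff_lt_of_le_iff_le (smul_le_smul_left_iff g)

theorem inv_smul_le_iff_le_smul (g : G) {x y : X} : g⁻¹ • x ≤ y ↔ x ≤ g • y := by
  rw [← smul_le_smul_left_iff g, smul_inv_smul]

theorem inv_smul_lt_iff_lt_smul (g : G) {x y : X} : g⁻¹ • x < y ↔ x < g • y := by
  rw [← smul_lt_smul_left_iff g, smul_inv_smul]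

theorem continuous_smul_of_covariantClass [TopologicalSpace X] [OrderTopology X] (g : G) :
    Continuous fun x : X => g • x :=
  (StrictMono.orderIsoOfSurjective _ (fun _ _ => (smul_lt_smul_left_iff g).mpr)
    (MulAction.surjective g)).continuous

end LinearOrder

section FreeAction

variable [ConditionallyCompleteLinearOrder X] [CovariantClass G X HSMul.hSMul LE.le]

theorem exists_lt_pow_smul {g : G} (hg : ∀ x : X, x < g • x) (y z : X) :
    ∃ n : ℕ, z < g ^ n • y := by
  by_contra! h
  have hbdd : BddAbove (Set.range fun n : ℕ => g ^ n • y) :=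
    ⟨z, Set.forall_mem_range.mpr h⟩
  obtain ⟨_, ⟨n, rfl⟩, hn⟩ := exists_lt_of_lt_csSup (Set.range_nonempty _)
    ((inv_smul_lt_iff_lt_smul g).mpr (hg (sSup (Set.range fun n : ℕ => g ^ n • y))))
  rw [inv_smul_lt_iff_lt_smul, smul_smul, ← pow_succ'] at hn
  exact (le_csSup hbdd ⟨n + 1, rfl⟩).not_gt hn

variable [DenselyOrdered X] [IsCancelSMul G X]

theorem lt_smul_of_lt_smul {g : G} {x : X} (h : x < g • x) (y : X) : y < g • y := by
  let _ : TopologicalSpace X := Preorder.topology X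
  have : OrderTopology X := ⟨rfl⟩
  by_contra! hy
  obtain ⟨z, -, hz⟩ := isPreconnected_univ.intermediate_value₂ (Set.mem_univ y) (Set.mem_univ x)
    (continuous_smul_of_covariantClass g).continuousOn continuousOn_id hy h.le
  rw [IsCancelSMul.eq_one_of_smul hz, one_smul] at h
  exact h.false

end FreeAction

/-- `T` records by how much the elements of `G` translate the line `X`: the elements of positive
translation number are exactly those that move points to the right. -/
def IsTranslationNumber (X : Type*) [LT X] [MulAction G X] (T : G →* Multiplicative ℝ) : Prop :=
  ∀ (g : G) (x : X), x < g • x ↔ 0 < (T g).toAdd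

open scoped IsMulCommutative in
/-- **Hölder's theorem**: the order on `G` given by an orbit is Archimedean, so that `G` embeds
into the real line. -/
theorem exists_isTranslationNumber [IsMulCommutative G] [ConditionallyCompleteLinearOrder X]
    [CovariantClass G X HSMul.hSMul LE.le] [DenselyOrdered X] [IsCancelSMul G X] [Nonempty X] :
    ∃ T : G →* Multiplicative ℝ, IsTranslationNumber X T := by
  obtain ⟨x₀⟩ := ‹Nonempty X›
  let _ : LinearOrder (Additive G) := LinearOrder.lift' (fun g => g.toMul • x₀)
    fun g h hgh => IsCancelSMul.right_cancel g.toMul h.toMul x₀ hgh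
  have : IsOrderedAddMonoid (Additive G) :=
    { add_le_add_left := fun a b hab c => by
        change (a + c).toMul • x₀ ≤ (b + c).toMul • x₀
        rw [add_comm a, add_comm b, toMul_add, toMul_add, mul_smul, mul_smul]
        exact smul_le_smul_left c.toMul hab }
  have pos_iff (g : Additive G) : 0 < g ↔ x₀ < g.toMul • x₀ := by
    change (0 : Additive G).toMul • x₀ < g.toMul • x₀ ↔ _
    rw [toMul_zero, one_smul]
  have : Archimedean (Additive G) := ⟨fun a b hb => by
    obtain ⟨n, hn⟩ :=
      exists_lt_pow_smul (lt_smul_of_lt_smul ((pos_iff b).mp hb)) x₀ (a.toMul • x₀)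
    exact ⟨n, hn.le⟩⟩
  obtain ⟨f, hf⟩ := Archimedean.exists_orderAddMonoidHom_real_injective (Additive G)
  refine ⟨AddMonoidHom.toMultiplicativeRight (f : Additive G →+ ℝ), fun g x => ?_⟩
  calc x < g • x ↔ x₀ < g • x₀ := ⟨(lt_smul_of_lt_smul · x₀), (lt_smul_of_lt_smul · x)⟩
    _ ↔ 0 < Additive.ofMul g := (pos_iff (Additive.ofMul g)).symm
    _ ↔ f 0 < f (Additive.ofMul g) := (f.monotone'.strictMono_of_injective hf).lt_iff_lt.symm
    _ ↔ 0 < f (Additive.ofMul g) := by rw [map_zero]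

theorem not_isCyclic_multiplicative_int_pi (ι : Type*) [Finite ι] [Nontrivial ι] :
    ¬ IsCyclic (Multiplicative (ι → ℤ)) := by
  rintro ⟨a, ha⟩
  have := Fintype.ofFinite ι
  have hle := finrank_le_one (R := ℤ) a.toAdd fun v => ha (.ofAdd v)
  rw [Module.finrank_fintype_fun_eq_card] at hle
  exact hle.not_gt Fintype.one_lt_card

theorem denseRange_toAdd_of_not_isCyclic {T : G →* Multiplicative ℝ} (hT : Function.Injective T)
    (hG : ¬ IsCyclic G) : DenseRange fun g => (T g).toAdd := by
  have : OrderTopology (Multiplicative ℝ) := inferInstanceAs (OrderTopology ℝ)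
  refine T.range.dense_or_cyclic.resolve_right ?_
  rintro ⟨a, ha⟩
  have : IsCyclic T.range := by
    rw [ha, ← Subgroup.zpowers_eq_closure]
    infer_instance
  exact hG (isCyclic_of_injective T.rangeRestrict (T.rangeRestrict_injective_iff.mpr hT))

theorem exists_wandering_interval [ConditionallyCompleteLinearOrder X]
    [CovariantClass G X HSMul.hSMul LE.le] {T : G →* Multiplicative ℝ}
    (hdense : DenseRange fun g => (T g).toAdd) {x q : X} (hxq : x < q)
    (h : ∀ g : G, 0 < (T g).toAdd → q ≤ g • x) :
    ∃ b : X, x < b ∧ (∀ g : G, 0 < (T g).toAdd → b ≤ g • x) ∧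
      ∀ r, b < r → ∃ g : G, 0 < (T g).toAdd ∧ g • b < r := by
  set A : Set X := (fun g : G => g • x) '' {g | 0 < (T g).toAdd}
  have hq : q ∈ lowerBounds A := Set.forall_mem_image.mpr h
  obtain ⟨e, he⟩ := hdense.exists_mem_open isOpen_Ioi (Set.nonempty_Ioi (a := (0 : ℝ)))
  have hne : A.Nonempty := ⟨e • x, e, he, rfl⟩
  have hb {g : G} (hg : 0 < (T g).toAdd) : sInf A ≤ g • x := csInf_le ⟨q, hq⟩ ⟨g, hg, rfl⟩
  refine ⟨sInf A, hxq.trans_le (le_csInf hne hq), fun g => hb, fun r hr => ?_⟩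
  obtain ⟨_, ⟨v, hv, rfl⟩, hvr⟩ := exists_lt_of_csInf_lt hne hr
  obtain ⟨u, hu, huv⟩ := hdense.exists_mem_open isOpen_Ioo (Set.nonempty_Ioo.mpr hv)
  refine ⟨u, hu, lt_of_le_of_lt ?_ hvr⟩
  rw [← inv_inv u, inv_smul_le_iff_le_smul, smul_smul]
  apply hb
  rwa [map_mul, map_inv, toAdd_mul, toAdd_inv, neg_add_eq_sub, sub_pos]

theorem smul_le_smul_or_smul_le_smul [LinearOrder X] [CovariantClass G X HSMul.hSMul LE.le]
    {T : G →* Multiplicative ℝ} (hT : Function.Injective T) {x b : X}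
    (hb : ∀ g : G, 0 < (T g).toAdd → b ≤ g • x) {g h : G} (hgh : g ≠ h) :
    g • b ≤ h • x ∨ h • b ≤ g • x := by
  have of_toAdd_lt {g h : G} (hlt : (T g).toAdd < (T h).toAdd) : g • b ≤ h • x := by
    rw [← smul_le_smul_left_iff g⁻¹, inv_smul_smul, smul_smul]
    apply hb
    rwa [map_mul, map_inv, toAdd_mul, toAdd_inv, neg_add_eq_sub, sub_pos]
  exact (lt_or_gt_of_ne (hT.ne hgh)).imp of_toAdd_lt of_toAdd_lt

namespace IsTranslationNumber

section LinearOrder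

variable [LinearOrder X] [CovariantClass G X HSMul.hSMul LE.le] {T : G →* Multiplicative ℝ}

theorem smul_lt_smul_iff (hT : IsTranslationNumber X T) {g h : G} (x : X) :
    g • x < h • x ↔ (T g).toAdd < (T h).toAdd := by
  rw [← smul_lt_smul_left_iff g⁻¹, inv_smul_smul, smul_smul, hT, map_mul, map_inv, toAdd_mul,
    toAdd_inv, neg_add_eq_sub, sub_pos]

theorem smul_le_smul_iff (hT : IsTranslationNumber X T) {g h : G} (x : X) :
    g • x ≤ h • x ↔ (T g).toAdd ≤ (T h).toAdd :=
  le_iff_le_iff_lt_iff_lt.mpr (hT.smul_lt_smul_iff x)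

theorem injective [Nonempty X] [IsCancelSMul G X] (hT : IsTranslationNumber X T) :
    Function.Injective T := by
  intro g h hgh
  obtain ⟨x⟩ := ‹Nonempty X›
  exact IsCancelSMul.right_cancel g h x
    (le_antisymm ((hT.smul_le_smul_iff x).mpr hgh.le) ((hT.smul_le_smul_iff x).mpr hgh.ge))

end LinearOrder

variable [ConditionallyCompleteLinearOrder X] [CovariantClass G X HSMul.hSMul LE.le]
  {T : G →* Multiplicative ℝ}

theorem exists_lt_smul (hT : IsTranslationNumber X T) {g : G} (hg : 0 < (T g).toAdd) (x y : X) :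
    ∃ n : ℕ, y < g ^ n • x :=
  exists_lt_pow_smul (fun z => (hT g z).mpr hg) x y

theorem exists_smul_mem_Ioo (hT : IsTranslationNumber X T) {g : G} (hg : 0 < (T g).toAdd)
    {p q : X} (hgq : g • p < q) (x : X) : ∃ h : G, h • x ∈ Set.Ioo p q := by
  obtain ⟨k, hk⟩ := hT.exists_lt_smul hg p x
  by_contra! hjump
  have stuck (n : ℕ) : g ^ n • (g ^ k)⁻¹ • x ≤ p := by
    induction n with
    | zero => simpa only [pow_zero, one_smul, inv_smul_le_iff_le_smul] using hk.le
    | succ n ih =>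
      have hlt : g ^ (n + 1) • (g ^ k)⁻¹ • x < q := by
        rw [pow_succ', mul_smul]
        exact (smul_le_smul_left g ih).trans_lt hgq
      rw [smul_smul] at hlt ⊢
      exact not_lt.mp fun hp => hjump _ ⟨hp, hlt⟩
  obtain ⟨n, hn⟩ := hT.exists_lt_smul hg ((g ^ k)⁻¹ • x) p
  exact (stuck n).not_gt hn

theorem isMinimal [Nontrivial X] [TopologicalSpace X] [OrderTopology X]
    (hT : IsTranslationNumber X T)
    (h : ∀ p q : X, p < q → ∃ g : G, 0 < (T g).toAdd ∧ g • p < q) : MulAction.IsMinimal G X where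
  dense_orbit x := dense_of_exists_between fun p q hpq => by
    obtain ⟨g, hg, hgq⟩ := h p q hpq
    obtain ⟨h, hh⟩ := hT.exists_smul_mem_Ioo hg hgq x
    exact ⟨h • x, ⟨h, rfl⟩, hh⟩

/-- The coordinate on the line `X` in which every element of `G` acts as the translation by its
translation number, normalised to vanish at `x₀`. Without the hypotheses below the supremum may be
the junk value `0`. -/
noncomputable def coord (T : G →* Multiplicative ℝ) (x₀ x : X) : ℝ :=
  sSup ((fun g => (T g).toAdd) '' {g | g • x₀ ≤ x})

section Coord

variable (hT : IsTranslationNumber X T) (hpos : ∃ g, 0 < (T g).toAdd)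
include hT hpos

theorem toAdd_le_coord {g : G} {x₀ x : X} (h : g • x₀ ≤ x) : (T g).toAdd ≤ coord T x₀ x := by
  obtain ⟨e, he⟩ := hpos
  obtain ⟨n, hn⟩ := hT.exists_lt_smul he x₀ x
  refine le_csSup ⟨(T (e ^ n)).toAdd, ?_⟩ ⟨g, h, rfl⟩
  rintro _ ⟨k, hk, rfl⟩
  exact (hT.smul_le_smul_iff x₀).mp (hk.trans hn.le)

theorem coord_le_of_forall {x₀ x : X} {r : ℝ} (h : ∀ g : G, g • x₀ ≤ x → (T g).toAdd ≤ r) :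
    coord T x₀ x ≤ r := by
  obtain ⟨e, he⟩ := hpos
  obtain ⟨n, hn⟩ := hT.exists_lt_smul he x x₀
  exact csSup_le ⟨_, (e ^ n)⁻¹, (inv_smul_le_iff_le_smul _).mpr hn.le, rfl⟩
    (Set.forall_mem_image.mpr h)

theorem coord_le_toAdd {g : G} {x₀ x : X} (h : x ≤ g • x₀) : coord T x₀ x ≤ (T g).toAdd :=
  hT.coord_le_of_forall hpos fun _ hk => (hT.smul_le_smul_iff x₀).mp (hk.trans h)

theorem coord_smul_self (g : G) (x₀ : X) : coord T x₀ (g • x₀) = (T g).toAdd :=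
  le_antisymm (hT.coord_le_toAdd hpos le_rfl) (hT.toAdd_le_coord hpos le_rfl)

theorem coord_add_le_coord_smul (g : G) (x₀ x : X) :
    coord T x₀ x + (T g).toAdd ≤ coord T x₀ (g • x) := by
  rw [← le_sub_iff_add_le]
  refine hT.coord_le_of_forall hpos fun h hh => ?_
  rw [le_sub_iff_add_le', ← toAdd_mul, ← map_mul]
  refine hT.toAdd_le_coord hpos ?_
  rw [mul_smul]
  exact smul_le_smul_left g hh

theorem coord_smul (g : G) (x₀ x : X) : coord T x₀ (g • x) = coord T x₀ x + (T g).toAdd := by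
  refine le_antisymm ?_ (hT.coord_add_le_coord_smul hpos g x₀ x)
  simpa only [map_inv, toAdd_inv, inv_smul_smul, ← sub_eq_add_neg, sub_le_iff_le_add]
    using hT.coord_add_le_coord_smul hpos g⁻¹ x₀ (g • x)

theorem strictMono_coord [DenselyOrdered X] [TopologicalSpace X] [OrderTopology X]
    [MulAction.IsMinimal G X] (x₀ : X) : StrictMono (coord T x₀) := by
  intro x y hxy
  obtain ⟨_, ⟨g, rfl⟩, hxg, hgy⟩ := (MulAction.dense_orbit G x₀).exists_between hxy
  obtain ⟨_, ⟨h, rfl⟩, hgh, hhy⟩ := (MulAction.dense_orbit G x₀).exists_between hgy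
  calc coord T x₀ x ≤ (T g).toAdd := hT.coord_le_toAdd hpos hxg.le
    _ < (T h).toAdd := (hT.smul_lt_smul_iff x₀).mp hgh
    _ ≤ coord T x₀ y := hT.toAdd_le_coord hpos hhy.le

end Coord

theorem surjective_coord [DenselyOrdered X] [TopologicalSpace X] [OrderTopology X]
    [MulAction.IsMinimal G X] (hT : IsTranslationNumber X T)
    (hdense : DenseRange fun g => (T g).toAdd) (x₀ : X) : Function.Surjective (coord T x₀) := by
  have hpos : ∃ g, 0 < (T g).toAdd := hdense.exists_mem_open isOpen_Ioi Set.nonempty_Ioi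
  have hcont : Continuous (coord T x₀) :=
    (hT.strictMono_coord hpos x₀).monotone.continuous_of_denseRange <| hdense.mono <|
      Set.range_subset_iff.mpr fun g => ⟨g • x₀, hT.coord_smul_self hpos g x₀⟩
  intro r
  obtain ⟨g, hg⟩ := hdense.exists_mem_open isOpen_Iio (Set.nonempty_Iio (a := r))
  obtain ⟨h, hh⟩ := hdense.exists_mem_open isOpen_Ioi (Set.nonempty_Ioi (a := r))
  exact mem_range_of_exists_le_of_exists_ge hcont
    ⟨g • x₀, (hT.coord_smul_self hpos g x₀).trans_le (le_of_lt hg)⟩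
    ⟨h • x₀, (hT.coord_smul_self hpos h x₀).ge.trans' (le_of_lt hh)⟩

theorem exists_homeomorph [Nonempty X] [DenselyOrdered X] [TopologicalSpace X] [OrderTopology X]
    [MulAction.IsMinimal G X] (hT : IsTranslationNumber X T)
    (hdense : DenseRange fun g => (T g).toAdd) :
    ∃ φ : X ≃ₜ ℝ, ∀ (g : G) (x : X), φ (g • x) = φ x + (T g).toAdd := by
  obtain ⟨x₀⟩ := ‹Nonempty X›
  have hpos : ∃ g, 0 < (T g).toAdd := hdense.exists_mem_open isOpen_Ioi Set.nonempty_Ioi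
  exact ⟨((hT.strictMono_coord hpos x₀).orderIsoOfSurjective _
    (hT.surjective_coord hdense x₀)).toHomeomorph, fun g x => hT.coord_smul hpos g x₀ x⟩

end IsTranslationNumber

end IncreasingActions

section LatticeSobolev

open Finset
open scoped BigOperators

section Resampling

variable {ι K : Type*} [DecidableEq ι] [Fintype ι] {α : ι → Type*} [AddCommMonoid K]
  [Module ℚ≥0 K]

theorem expect_expect_piecewise (t : ∀ i, Finset (α i)) (s : Finset ι) (F : (∀ i, α i) → K) :
    𝔼 p ∈ Fintype.piFinset t, 𝔼 q ∈ Fintype.piFinset t, F (s.piecewise q p) =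
      𝔼 p ∈ Fintype.piFinset t, F p := by
  obtain ht | ht := (Fintype.piFinset t).eq_empty_or_nonempty
  · simp only [ht, expect_empty]
  have hmem : ∀ z ∈ Fintype.piFinset t ×ˢ Fintype.piFinset t,
      (s.piecewise z.2 z.1, s.piecewise z.1 z.2) ∈ Fintype.piFinset t ×ˢ Fintype.piFinset t := by
    simp only [mem_product, Fintype.mem_piFinset]
    exact fun z hz => ⟨fun i => s.piecewise_cases _ _ (· ∈ t i) (hz.2 i) (hz.1 i),
      fun i => s.piecewise_cases _ _ (· ∈ t i) (hz.1 i) (hz.2 i)⟩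
  calc _ = 𝔼 p ∈ Fintype.piFinset t, 𝔼 _q ∈ Fintype.piFinset t, F p := ?_
    _ = 𝔼 p ∈ Fintype.piFinset t, F p := by simp only [expect_const ht]
  simp only [← expect_product']
  refine expect_nbij' (fun z => (s.piecewise z.2 z.1, s.piecewise z.1 z.2))
    (fun z => (s.piecewise z.2 z.1, s.piecewise z.1 z.2)) hmem hmem ?_ ?_ fun _ _ => rfl
  all_goals
    intro z _
    ext i <;> by_cases hi : i ∈ s <;> simp [hi]

theorem expect_expect_update (t : ∀ i, Finset (α i)) (j : ι) (F : (∀ i, α i) → K) :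
    𝔼 p ∈ Fintype.piFinset t, 𝔼 u ∈ t j, F (Function.update p j u) =
      𝔼 p ∈ Fintype.piFinset t, F p := by
  obtain ht | ⟨q, hq⟩ := (Fintype.piFinset t).eq_empty_or_nonempty
  · simp only [ht, expect_empty]
  have hmem : ∀ z ∈ Fintype.piFinset t ×ˢ t j,
      (Function.update z.1 j z.2, z.1 j) ∈ Fintype.piFinset t ×ˢ t j := by
    simp only [mem_product, Fintype.mem_piFinset]
    refine fun z hz => ⟨fun i => ?_, hz.1 j⟩
    rcases eq_or_ne i j with rfl | hij
    · simpa using hz.2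
    · simpa [hij] using hz.1 i
  calc _ = 𝔼 p ∈ Fintype.piFinset t, 𝔼 _u ∈ t j, F p := ?_
    _ = 𝔼 p ∈ Fintype.piFinset t, F p := by
      simp only [expect_const ⟨q j, Fintype.mem_piFinset.mp hq j⟩]
  simp only [← expect_product']
  refine expect_nbij' (fun z => (Function.update z.1 j z.2, z.1 j))
    (fun z => (Function.update z.1 j z.2, z.1 j)) hmem hmem ?_ ?_ fun _ _ => rfl <;> simp

theorem expect_expect_expect_update_piecewise (t : ∀ i, Finset (α i)) (s : Finset ι) (j : ι)
    (F : (∀ i, α i) → K) :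
    𝔼 p ∈ Fintype.piFinset t, 𝔼 q ∈ Fintype.piFinset t, 𝔼 u ∈ t j,
      F (Function.update (s.piecewise q p) j u) = 𝔼 p ∈ Fintype.piFinset t, F p := by
  rw [expect_expect_piecewise t s fun p => 𝔼 u ∈ t j, F (Function.update p j u),
    expect_expect_update]

end Resampling

theorem abs_expect_sub_expect_le {α : Type*} {s t : Finset α} (hst : s ⊆ t) (hs : s.Nonempty)
    (f : α → ℝ) :
    |𝔼 p ∈ s, f p - 𝔼 q ∈ t, f q| ≤ (#t / #s : ℝ) * 𝔼 p ∈ t, 𝔼 q ∈ t, |f p - f q| := by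
  calc |𝔼 p ∈ s, f p - 𝔼 q ∈ t, f q| = |𝔼 p ∈ s, 𝔼 q ∈ t, (f p - f q)| := by
        simp only [expect_sub_distrib, expect_const (hs.mono hst), expect_const hs]
    _ ≤ 𝔼 p ∈ s, 𝔼 q ∈ t, |f p - f q| :=
        (abs_expect_le _ _).trans (expect_le_expect fun p _ => abs_expect_le _ _)
    _ ≤ (#s : ℝ)⁻¹ * ∑ p ∈ t, 𝔼 q ∈ t, |f p - f q| := by
        rw [expect_eq_sum_div_card, div_eq_inv_mul]
        gcongr
    _ = (#t / #s : ℝ) * 𝔼 p ∈ t, 𝔼 q ∈ t, |f p - f q| := by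
        rw [← card_mul_expect, ← mul_assoc, inv_mul_eq_div]

theorem le_add_sum_range_of_step {g h : ℤ → ℝ} {ε : ℤ} (hg : ∀ u, g (u + ε) ≤ g u + h u) (s : ℤ)
    (n : ℕ) : g (s + n * ε) ≤ g s + ∑ k ∈ range n, h (s + k * ε) := by
  induction n with
  | zero => simp
  | succ n ih =>
    rw [sum_range_succ, Nat.cast_succ, add_one_mul, ← add_assoc]
    linarith [hg (s + n * ε)]

theorem le_add_sum_of_step {g h : ℤ → ℝ} (hh : 0 ≤ h)
    (hg : ∀ (u : ℤ) (ε : ℤˣ), g (u + ε) ≤ g u + h u) {a b s t : ℤ} (hs : s ∈ Ico a b)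
    (ht : t ∈ Ico a b) : g t ≤ g s + ∑ u ∈ Ico a b, h u := by
  obtain ⟨n, ε, rfl⟩ : ∃ (n : ℕ) (ε : ℤˣ), t = s + n * ε := by
    rcases le_total s t with hst | hst
    · exact ⟨(t - s).toNat, 1, by simp [hst]⟩
    · exact ⟨(s - t).toNat, -1, by simp [hst]⟩
  refine (le_add_sum_range_of_step (hg · ε) s n).trans (add_le_add_right ?_ _)
  rw [mem_Ico] at hs ht
  have hinj : Set.InjOn (fun k : ℕ => s + k * (ε : ℤ)) (range n) := fun k _ l _ hkl => by
    simpa using hkl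
  rw [← sum_image (f := h) hinj]
  refine sum_le_sum_of_subset_of_nonneg (image_subset_iff.mpr fun k hk => ?_) fun u _ _ => hh u
  rw [mem_range] at hk
  rw [mem_Ico]
  rcases Int.units_eq_one_or ε with rfl | rfl <;>
    simp only [Units.val_one, Units.val_neg] at hs ht ⊢ <;> omega

/-- `w` is a discrete upper gradient of `f`: a step from `y` to a neighbour of `y` in `ℤ^ι`
increases `f` by at most `w y`. -/
def IsUpperGradient {ι : Type*} [DecidableEq ι] (w f : (ι → ℤ) → ℝ) : Prop :=
  ∀ (y : ι → ℤ) (i : ι) (ε : ℤˣ), f (y + Pi.single i (ε : ℤ)) ≤ f y + w y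

namespace IsUpperGradient

theorem abs_sub_update_le {ι : Type*} [DecidableEq ι] {w f : (ι → ℤ) → ℝ} (hw : 0 ≤ w)
    (hf : IsUpperGradient w f) (y : ι → ℤ) (j : ι) {a b u : ℤ}
    (hy : y j ∈ Ico a b) (hu : u ∈ Ico a b) :
    |f y - f (Function.update y j u)| ≤ ∑ v ∈ Ico a b, w (Function.update y j v) := by
  have step (v : ℤ) (ε : ℤˣ) : f (Function.update y j (v + ε)) ≤
      f (Function.update y j v) + w (Function.update y j v) := by
    convert hf (Function.update y j v) j ε using 2
    ext i
    rcases eq_or_ne i j with rfl | hij <;> simp [*]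
  have hle {s t : ℤ} (hs : s ∈ Ico a b) (ht : t ∈ Ico a b) :=
    le_add_sum_of_step (g := fun v => f (Function.update y j v))
      (fun v => hw (Function.update y j v)) step hs ht
  rw [abs_sub_le_iff, sub_le_iff_le_add', sub_le_iff_le_add']
  simpa using And.intro (hle hu hy) (hle hy hu)

end IsUpperGradient

/-- The cube of side `N` in `ℤ^ι` whose least corner is `a`. -/
noncomputable def latticeCube {ι : Type*} [Fintype ι] [DecidableEq ι] (a : ι → ℤ) (N : ℕ) :
    Finset (ι → ℤ) :=
  Fintype.piFinset fun i => Ico (a i) (a i + N)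

variable {ι : Type*} [Fintype ι] [DecidableEq ι] {a b : ι → ℤ} {M N : ℕ}

theorem mem_latticeCube {x : ι → ℤ} : x ∈ latticeCube a N ↔ ∀ i, x i ∈ Ico (a i) (a i + N) :=
  Fintype.mem_piFinset

theorem card_latticeCube : #(latticeCube a N) = N ^ Fintype.card ι := by
  simp [latticeCube]

theorem latticeCube_nonempty (hN : 0 < N) : (latticeCube a N).Nonempty :=
  card_pos.mp (card_latticeCube (a := a) ▸ pow_pos hN _)

theorem latticeCube_one : latticeCube a 1 = {a} := by
  ext x
  simp only [mem_latticeCube, mem_Ico, mem_singleton, funext_iff]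
  exact forall_congr' fun i => by omega

theorem latticeCube_subset_latticeCube (hab : b ≤ a) (h : ∀ i, a i + M ≤ b i + N) :
    latticeCube a M ⊆ latticeCube b N :=
  Fintype.piFinset_subset _ _ fun i => Ico_subset_Ico (hab i) (h i)

theorem expect_le_rpow_mul {α : Type*} {s : Finset α} {w : α → ℝ} {p A : ℝ} (hp : 1 ≤ p)
    (hA : 0 ≤ A) (hw : 0 ≤ w) (h : ∑ y ∈ s, w y ^ p ≤ A ^ p) :
    𝔼 y ∈ s, w y ≤ (#s : ℝ) ^ (-p⁻¹) * A := by
  obtain rfl | hs := s.eq_empty_or_nonempty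
  · simp only [expect_empty]
    positivity
  have hcard : (0 : ℝ) < #s := by exact_mod_cast hs.card_pos
  have hp0 : 0 < p := one_pos.trans_le hp
  rw [← Real.rpow_le_rpow_iff (expect_nonneg fun y _ => hw y) (by positivity) hp0]
  calc (𝔼 y ∈ s, w y) ^ p = (#s : ℝ) ^ (-p) * (∑ y ∈ s, w y) ^ p := by
        rw [expect_eq_sum_div_card, Real.div_rpow (sum_nonneg fun y _ => hw y) hcard.le,
          Real.rpow_neg hcard.le, inv_mul_eq_div]
    _ ≤ (#s : ℝ) ^ (-p) * ((#s : ℝ) ^ (p - 1) * ∑ y ∈ s, w y ^ p) := by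
        gcongr
        exact Real.rpow_sum_le_const_mul_sum_rpow_of_nonneg s hp fun y _ => hw y
    _ ≤ (#s : ℝ) ^ (-p) * ((#s : ℝ) ^ (p - 1) * A ^ p) := by gcongr
    _ = ((#s : ℝ) ^ (-p⁻¹) * A) ^ p := by
        rw [Real.mul_rpow (by positivity) hA, ← Real.rpow_mul hcard.le, ← mul_assoc,
          ← Real.rpow_add hcard]
        congr 2
        field_simp
        ring

theorem side_mul_expect_latticeCube_le {w : (ι → ℤ) → ℝ} {p A : ℝ} (hp : 1 ≤ p) (hA : 0 ≤ A)
    (hw : 0 ≤ w) (h : ∑ y ∈ latticeCube a N, w y ^ p ≤ A ^ p) (hN : 0 < N) :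
    N * 𝔼 y ∈ latticeCube a N, w y ≤ (N : ℝ) ^ (1 - Fintype.card ι / p) * A := by
  have hN' : (0 : ℝ) < N := by exact_mod_cast hN
  calc N * 𝔼 y ∈ latticeCube a N, w y
      ≤ N * ((#(latticeCube a N) : ℝ) ^ (-p⁻¹) * A) := by
        gcongr
        exact expect_le_rpow_mul hp hA hw h
    _ = (N : ℝ) ^ (1 - Fintype.card ι / p) * A := by
        rw [card_latticeCube, Nat.cast_pow, ← Real.rpow_natCast, ← Real.rpow_mul hN'.le,
          ← mul_assoc, sub_eq_add_neg, Real.rpow_add hN', Real.rpow_one, mul_neg, div_eq_mul_inv]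

namespace IsUpperGradient

variable {w f : (ι → ℤ) → ℝ}

theorem expect_abs_sub_piecewise_le (hw : 0 ≤ w) (hf : IsUpperGradient w f) (s : Finset ι) :
    𝔼 p ∈ latticeCube a N, 𝔼 q ∈ latticeCube a N, |f p - f (s.piecewise q p)| ≤
      #s * (N * 𝔼 y ∈ latticeCube a N, w y) := by
  induction s using Finset.induction_on with
  | empty => simp
  | insert j s hj ih =>
    set Q := latticeCube a N
    have move (p q) (hp : p ∈ Q) (hq : q ∈ Q) :
        |f (s.piecewise q p) - f ((insert j s).piecewise q p)| ≤
          N * 𝔼 v ∈ Ico (a j) (a j + N), w (Function.update (s.piecewise q p) j v) := by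
      rw [mem_latticeCube] at hp hq
      rw [piecewise_insert]
      convert hf.abs_sub_update_le hw _ j _ (hq j) using 1
      · rw [← card_mul_expect, Int.card_Ico, add_sub_cancel_left, Int.toNat_natCast]
      · rw [piecewise_eq_of_notMem _ _ _ hj]
        exact hp j
    have hmean : 𝔼 p ∈ Q, 𝔼 q ∈ Q, 𝔼 v ∈ Ico (a j) (a j + N),
        w (Function.update (s.piecewise q p) j v) = 𝔼 y ∈ Q, w y :=
      expect_expect_expect_update_piecewise (fun i => Ico (a i) (a i + N)) s j w
    calc _ ≤ 𝔼 p ∈ Q, 𝔼 q ∈ Q, (|f p - f (s.piecewise q p)| +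
          N * 𝔼 v ∈ Ico (a j) (a j + N), w (Function.update (s.piecewise q p) j v)) :=
          expect_le_expect fun p hp => expect_le_expect fun q hq =>
            (abs_sub_le _ _ _).trans (add_le_add_right (move p q hp hq) _)
      _ = 𝔼 p ∈ Q, 𝔼 q ∈ Q, |f p - f (s.piecewise q p)| + N * 𝔼 y ∈ Q, w y := by
          simp only [expect_add_distrib, ← mul_expect, hmean]
      _ ≤ #s * (N * 𝔼 y ∈ Q, w y) + N * 𝔼 y ∈ Q, w y := add_le_add_left ih _
      _ = #(insert j s) * (N * 𝔼 y ∈ Q, w y) := by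
          rw [card_insert_of_notMem hj, Nat.cast_succ, add_one_mul]

theorem expect_abs_sub_le (hw : 0 ≤ w) (hf : IsUpperGradient w f) :
    𝔼 p ∈ latticeCube a N, 𝔼 q ∈ latticeCube a N, |f p - f q| ≤
      Fintype.card ι * (N * 𝔼 y ∈ latticeCube a N, w y) := by
  simpa only [piecewise_univ, card_univ] using hf.expect_abs_sub_piecewise_le (a := a) hw univ

theorem abs_expect_dyadic_sub_le {p A : ℝ} (hp : 1 ≤ p) (hA : 0 ≤ A) (hw : 0 ≤ w)
    (hwA : ∀ s : Finset (ι → ℤ), ∑ y ∈ s, w y ^ p ≤ A ^ p) (hf : IsUpperGradient w f) {k : ℕ}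
    (hab : latticeCube a (2 ^ k) ⊆ latticeCube b (2 ^ (k + 1))) :
    |𝔼 y ∈ latticeCube a (2 ^ k), f y - 𝔼 y ∈ latticeCube b (2 ^ (k + 1)), f y| ≤
      2 ^ Fintype.card ι * Fintype.card ι * A *
        ((2 : ℝ) ^ (1 - Fintype.card ι / p)) ^ (k + 1) := by
  have hcard : (#(latticeCube b (2 ^ (k + 1))) / #(latticeCube a (2 ^ k)) : ℝ) =
      2 ^ Fintype.card ι := by
    simp only [card_latticeCube, Nat.cast_pow, Nat.cast_ofNat]
    rw [← div_pow, pow_succ', mul_div_cancel_right₀ _ (pow_ne_zero k two_ne_zero)]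
  calc _ ≤ (2 : ℝ) ^ Fintype.card ι *
        (Fintype.card ι * ((2 ^ (k + 1) : ℕ) * 𝔼 y ∈ latticeCube b (2 ^ (k + 1)), w y)) := by
        refine (abs_expect_sub_expect_le hab (latticeCube_nonempty (pow_pos two_pos k)) f).trans ?_
        rw [hcard]
        gcongr
        exact hf.expect_abs_sub_le hw
    _ ≤ (2 : ℝ) ^ Fintype.card ι *
        (Fintype.card ι * (((2 ^ (k + 1) : ℕ) : ℝ) ^ (1 - Fintype.card ι / p) * A)) := by
        refine mul_le_mul_of_nonneg_left (mul_le_mul_of_nonneg_left ?_ (Nat.cast_nonneg _))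
          (by positivity)
        exact side_mul_expect_latticeCube_le hp hA hw (hwA _) (pow_pos two_pos (k + 1))
    _ = _ := by
        rw [Nat.cast_pow, Nat.cast_ofNat, ← Real.rpow_natCast_mul two_pos.le,
          ← Real.rpow_mul_natCast two_pos.le, mul_comm ((k + 1 : ℕ) : ℝ)]
        ring

theorem abs_sub_expect_latticeCube_le {p A : ℝ} (hp : 1 ≤ p) (hA : 0 ≤ A) (hw : 0 ≤ w)
    (hwA : ∀ s : Finset (ι → ℤ), ∑ y ∈ s, w y ^ p ≤ A ^ p) (hf : IsUpperGradient w f)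
    {c : ℕ → ι → ℤ} (hc : ∀ k, latticeCube (c k) (2 ^ k) ⊆ latticeCube (c (k + 1)) (2 ^ (k + 1)))
    (hpd : p < Fintype.card ι) (n : ℕ) :
    |f (c 0) - 𝔼 y ∈ latticeCube (c n) (2 ^ n), f y| ≤
      2 ^ Fintype.card ι * Fintype.card ι * A * (1 - (2 : ℝ) ^ (1 - Fintype.card ι / p))⁻¹ := by
  set r := (2 : ℝ) ^ (1 - Fintype.card ι / p)
  have hr₀ : 0 ≤ r := Real.rpow_nonneg two_pos.le _
  have hr : r < 1 := Real.rpow_lt_one_of_one_lt_of_neg one_lt_two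
    (sub_neg.mpr ((one_lt_div (one_pos.trans_le hp)).mpr hpd))
  have hsum := dist_le_range_sum_of_dist_le (f := fun k => 𝔼 y ∈ latticeCube (c k) (2 ^ k), f y)
    n fun {k} _ =>
      (Real.dist_eq _ _).trans_le (hf.abs_expect_dyadic_sub_le hp hA hw hwA (hc k))
  simp only [pow_zero, latticeCube_one, expect_singleton, ← mul_sum, Real.dist_eq] at hsum
  refine hsum.trans ?_
  gcongr
  calc ∑ k ∈ range n, r ^ (k + 1) ≤ ∑ k ∈ range n, r ^ k :=
        sum_le_sum fun k _ => pow_le_pow_of_le_one hr₀ hr.le k.le_succ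
    _ ≤ ∑' k, r ^ k := (summable_geometric_of_lt_one hr₀ hr).sum_le_tsum _
        fun k _ => pow_nonneg hr₀ k
    _ = (1 - r)⁻¹ := tsum_geometric_of_lt_one hr₀ hr

theorem eventually_abs_sub_expect_latticeCube_le {p A : ℝ} (hp : 1 ≤ p) (hA : 0 ≤ A)
    (hw : 0 ≤ w) (hwA : ∀ s : Finset (ι → ℤ), ∑ y ∈ s, w y ^ p ≤ A ^ p)
    (hf : IsUpperGradient w f) (hpd : p < Fintype.card ι) {x : ι → ℤ} (hax : a ≤ x) :
    ∀ᶠ n : ℕ in Filter.atTop, |f x - 𝔼 y ∈ latticeCube a (2 ^ n), f y| ≤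
      2 ^ Fintype.card ι * Fintype.card ι * A * (1 - (2 : ℝ) ^ (1 - Fintype.card ι / p))⁻¹ := by
  set c : ℕ → ι → ℤ := fun k i => max (a i) (x i - 2 ^ k + 1) with hc
  have hc_zero : c 0 = x := by
    ext i
    simpa [hc] using hax i
  have hnested (k : ℕ) : latticeCube (c k) (2 ^ k) ⊆ latticeCube (c (k + 1)) (2 ^ (k + 1)) := by
    have hpow : (0 : ℤ) < 2 ^ k := pow_pos two_pos k
    refine latticeCube_subset_latticeCube (fun i => ?_) fun i => ?_ <;>
      simp only [hc, pow_succ, Nat.cast_mul, Nat.cast_pow, Nat.cast_ofNat] <;> omega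
  have hc_eventually : ∀ᶠ n in Filter.atTop, c n = a := by
    simp only [funext_iff, Filter.eventually_all]
    intro i
    filter_upwards [(tendsto_pow_atTop_atTop_of_one_lt one_lt_two).eventually_ge_atTop
      (x i - a i + 1)] with n hn
    exact max_eq_left (by linarith)
  filter_upwards [hc_eventually] with n hn
  simpa only [hc_zero, hn] using hf.abs_sub_expect_latticeCube_le hp hA hw hwA hnested hpd n

/-- **Discrete Morrey inequality**: the means of `f` over increasing dyadic cubes around a point
differ by the terms of a geometric series. -/
theorem exists_abs_sub_le (ι : Type*) [Fintype ι] [DecidableEq ι] {p : ℝ} (hp : 1 ≤ p)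
    (hpd : p < Fintype.card ι) :
    ∃ S : ℝ, ∀ A ≥ 0, ∀ w f : (ι → ℤ) → ℝ, 0 ≤ w →
      (∀ s : Finset (ι → ℤ), ∑ y ∈ s, w y ^ p ≤ A ^ p) → IsUpperGradient w f →
      ∀ x y, |f x - f y| ≤ S * A := by
  refine ⟨2 * (2 ^ Fintype.card ι * Fintype.card ι *
    (1 - (2 : ℝ) ^ (1 - Fintype.card ι / p))⁻¹), fun A hA w f hw hwA hf x y => ?_⟩
  obtain ⟨n, hx, hy⟩ :=
    ((hf.eventually_abs_sub_expect_latticeCube_le hp hA hw hwA hpd inf_le_left).and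
      (hf.eventually_abs_sub_expect_latticeCube_le hp hA hw hwA hpd inf_le_right)).exists
      (f := Filter.atTop)
  rw [abs_sub_comm] at hy
  refine ((abs_sub_le _ _ _).trans (add_le_add hx hy)).trans_eq ?_
  ring

end IsUpperGradient

end LatticeSobolev

section Distortion

/-- The logarithm of the ratio of the lengths of the adjacent intervals `[m, t]` and `[s, m]`. It
is the quantity whose variation along an orbit is controlled. -/
noncomputable def logRatio (s m t : ℝ) : ℝ :=
  Real.log ((t - m) / (m - s))

theorem logRatio_neg_iff {s m t : ℝ} (hsm : s < m) (hmt : m < t) :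
    logRatio s m t < 0 ↔ t - m < m - s := by
  rw [logRatio, Real.log_neg_iff (div_pos (sub_pos.mpr hmt) (sub_pos.mpr hsm)),
    div_lt_one (sub_pos.mpr hsm)]

theorem logRatio_le_log {s m t κ : ℝ} (hsm : s < m) (hmt : m < t) (h : t - m ≤ κ * (m - s)) :
    logRatio s m t ≤ Real.log κ :=
  Real.log_le_log (div_pos (sub_pos.mpr hmt) (sub_pos.mpr hsm))
    ((div_le_iff₀ (sub_pos.mpr hsm)).mpr h)

theorem logRatio_map_le_of_holder {f f' : ℝ → ℝ} {a b δ H τ : ℝ}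
    (hf : ∀ x ∈ Set.Icc a b, HasDerivWithinAt f (f' x) (Set.Icc a b) x) (hδ : 0 < δ)
    (hf' : ∀ x ∈ Set.Icc a b, δ ≤ f' x) (hτ : 0 ≤ τ) (hH : 0 ≤ H)
    (hholder : ∀ x ∈ Set.Icc a b, ∀ y ∈ Set.Icc a b, |f' x - f' y| ≤ H * |x - y| ^ τ)
    {s m t : ℝ} (has : a ≤ s) (hsm : s < m) (hmt : m < t) (htb : t ≤ b) :
    logRatio (f s) (f m) (f t) ≤ logRatio s m t + H / δ * (t - s) ^ τ := by
  have slope {u v : ℝ} (hau : a ≤ u) (huv : u < v) (hvb : v ≤ b) :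
      ∃ ξ ∈ Set.Ioo u v, f v - f u = f' ξ * (v - u) := by
    have hsub : Set.Icc u v ⊆ Set.Icc a b := Set.Icc_subset_Icc hau hvb
    obtain ⟨ξ, hξ, h⟩ := exists_hasDerivAt_eq_slope f f' huv
      (fun x hx => (hf x (hsub hx)).continuousWithinAt.mono hsub) fun x hx =>
        (hf x (hsub (Set.Ioo_subset_Icc_self hx))).hasDerivAt
          (Icc_mem_nhds (hau.trans_lt hx.1) (hx.2.trans_le hvb))
    exact ⟨ξ, hξ, by rw [h, div_mul_cancel₀ _ (sub_pos.mpr huv).ne']⟩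
  obtain ⟨ξ, ⟨hsξ, hξm⟩, hξ⟩ := slope has hsm (hmt.le.trans htb)
  obtain ⟨η, ⟨hmη, hηt⟩, hη⟩ := slope (has.trans hsm.le) hmt htb
  have hξI : ξ ∈ Set.Icc a b := ⟨by linarith, by linarith⟩
  have hηI : η ∈ Set.Icc a b := ⟨by linarith, by linarith⟩
  have hξ0 : 0 < f' ξ := hδ.trans_le (hf' ξ hξI)
  have hη0 : 0 < f' η := hδ.trans_le (hf' η hηI)
  calc logRatio (f s) (f m) (f t) = logRatio s m t + Real.log (f' η / f' ξ) := by
        rw [logRatio, logRatio, hξ, hη, mul_div_mul_comm, mul_comm,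
          Real.log_mul (div_pos (sub_pos.mpr hmt) (sub_pos.mpr hsm)).ne' (div_pos hη0 hξ0).ne']
    _ ≤ logRatio s m t + (f' η - f' ξ) / f' ξ := by
        rw [sub_div, div_self hξ0.ne']
        gcongr
        exact Real.log_le_sub_one_of_pos (div_pos hη0 hξ0)
    _ ≤ logRatio s m t + H * |η - ξ| ^ τ / δ := by
        gcongr
        · exact (le_abs_self _).trans (hholder η hηI ξ hξI)
        · exact hf' ξ hξI
    _ ≤ logRatio s m t + H * (t - s) ^ τ / δ := by
        gcongr
        rw [abs_of_pos] <;> linarith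
    _ = logRatio s m t + H / δ * (t - s) ^ τ := by rw [mul_div_right_comm]

end Distortion

theorem sum_sub_le_of_nonoverlapping {ι : Type*} {p q : ℝ} {a b : ι → ℝ} (hpq : p ≤ q)
    (ha : ∀ i, p ≤ a i) (hb : ∀ i, b i ≤ q) (hab : ∀ i, a i ≤ b i)
    (hdisj : Pairwise fun i j => b i ≤ a j ∨ b j ≤ a i) (s : Finset ι) :
    ∑ i ∈ s, (b i - a i) ≤ q - p := by
  have hdisj' : Pairwise (Function.onFun Disjoint fun i => Set.Ioo (a i) (b i)) := fun i j hij =>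
    Set.disjoint_left.mpr fun x hi hj => (hdisj hij).elim
      (fun h => (hi.2.trans_le h).not_gt hj.1) fun h => (hj.2.trans_le h).not_gt hi.1
  calc ∑ i ∈ s, (b i - a i) = MeasureTheory.volume.real (⋃ i ∈ s, Set.Ioo (a i) (b i)) := by
        rw [MeasureTheory.measureReal_biUnion_finset (hdisj'.set_pairwise _)
          (fun i _ => measurableSet_Ioo) fun i _ => measure_Ioo_lt_top.ne]
        exact Finset.sum_congr rfl fun i _ => (Real.volume_real_Ioo_of_le (hab i)).symm
    _ ≤ MeasureTheory.volume.real (Set.Icc p q) :=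
        MeasureTheory.measureReal_mono (Set.iUnion₂_subset fun i _ =>
          Set.Ioo_subset_Icc_self.trans (Set.Icc_subset_Icc (ha i) (hb i)))
          measure_Icc_lt_top.ne
    _ = q - p := Real.volume_real_Icc_of_le hpq

theorem exists_forall_neg_of_step_le (ι : Type*) [Fintype ι] [Nonempty ι]
    [DecidableEq ι] {τ : ℝ} (hτ : 1 / (Fintype.card ι : ℝ) < τ) (hτ_le : τ ≤ 1) :
    ∃ S : ℝ, ∀ C ≥ 0, ∀ l ρ : (ι → ℤ) → ℝ, 0 ≤ l → (∀ s : Finset (ι → ℤ), ∑ y ∈ s, l y ≤ 1) →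
      (∀ y i (ε : ℤˣ), ρ y < 0 → ρ (y + Pi.single i (ε : ℤ)) ≤ ρ y + C * l y ^ τ) →
      ∀ x y, ρ x + S * C < 0 → ρ y < 0 := by
  have hτ0 : 0 < τ := lt_of_le_of_lt (by positivity) hτ
  obtain ⟨S, hS⟩ := IsUpperGradient.exists_abs_sub_le ι ((one_le_inv₀ hτ0).mpr hτ_le)
    (inv_lt_of_inv_lt₀ (Nat.cast_pos.mpr Fintype.card_pos) (by rwa [← one_div]))
  refine ⟨S, fun C hC l ρ hl hsum hstep x y hx => ?_⟩
  have hw : 0 ≤ fun z => C * l z ^ τ := fun z => mul_nonneg hC (Real.rpow_nonneg (hl z) τ)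
  have hsum_w (s : Finset (ι → ℤ)) : ∑ z ∈ s, (C * l z ^ τ) ^ τ⁻¹ ≤ C ^ τ⁻¹ := by
    have hpow (z : ι → ℤ) : (C * l z ^ τ) ^ τ⁻¹ = C ^ τ⁻¹ * l z := by
      rw [Real.mul_rpow hC (Real.rpow_nonneg (hl z) τ), Real.rpow_rpow_inv (hl z) hτ0.ne']
    simp only [hpow, ← Finset.mul_sum]
    exact mul_le_of_le_one_right (by positivity) (hsum s)
  -- Truncating `ρ` at `0` discards the points where the step estimate is not available.
  have hgrad : IsUpperGradient (fun z => C * l z ^ τ) (fun z => min (ρ z) 0) := by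
    intro z i ε
    change min (ρ _) 0 ≤ min (ρ z) 0 + C * l z ^ τ
    rcases lt_or_ge (ρ z) 0 with hz | hz
    · rw [min_eq_left hz.le]
      exact (min_le_left _ _).trans (hstep z i ε hz)
    · rw [min_eq_right hz, zero_add]
      exact (min_le_right _ _).trans (hw z)
  have hxy := (abs_sub_le_iff.mp (hS C hC _ _ hw hsum_w hgrad x y)).2
  have hmin : min (ρ y) 0 < 0 := by linarith [min_le_left (ρ x) 0]
  exact (min_lt_iff.mp hmin).resolve_right (lt_irrefl 0)

theorem exists_forall_sub_lt_sub_of_logRatio_step_le (ι : Type*) [Fintype ι] [Nonempty ι]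
    [DecidableEq ι] {τ : ℝ} (hτ : 1 / (Fintype.card ι : ℝ) < τ) (hτ_le : τ ≤ 1) :
    ∃ S : ℝ, ∀ C ≥ 0, ∀ s m t : (ι → ℤ) → ℝ, (∀ y, s y < m y) → (∀ y, m y < t y) →
      (∀ F : Finset (ι → ℤ), ∑ y ∈ F, (m y - s y) ≤ 1) →
      (∀ y i (ε : ℤˣ), ∀ z, z = y + Pi.single i (ε : ℤ) →
        logRatio (s z) (m z) (t z) ≤ logRatio (s y) (m y) (t y) + C * (t y - s y) ^ τ) →
      ∀ x y, logRatio (s x) (m x) (t x) + S * C < 0 → t y - m y < m y - s y := by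
  obtain ⟨S, hS⟩ := exists_forall_neg_of_step_le ι hτ hτ_le
  refine ⟨S * 2 ^ τ, fun C hC s m t hsm hmt hsum hstep x y hx => ?_⟩
  rw [← logRatio_neg_iff (hsm y) (hmt y)]
  refine hS (C * 2 ^ τ) (by positivity) (fun y => m y - s y)
    (fun y => logRatio (s y) (m y) (t y)) (fun y => sub_nonneg.mpr (hsm y).le) hsum
    (fun y i ε hy => (hstep y i ε _ rfl).trans ?_) x y (by linarith)
  rw [logRatio_neg_iff (hsm y) (hmt y)] at hy
  have hτ0 : 0 ≤ τ := le_trans (by positivity) hτ.le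
  have hst : 0 ≤ t y - s y := sub_nonneg.mpr ((hsm y).trans (hmt y)).le
  rw [mul_assoc, ← Real.mul_rpow two_pos.le (sub_nonneg.mpr (hsm y).le)]
  gcongr
  linarith

namespace HomeoPlus

instance (Γ : Subgroup HomeoPlus) :
    CovariantClass Γ (Set.Ioo (0 : I) 1) HSMul.hSMul LE.le where
  elim g _ _ h := g.1.2.monotone h

theorem toReal_coe (f : HomeoPlus) (x : I) : toReal f x = f.1 x :=
  Set.IccExtend_val _ _ x

theorem monotone_toReal (f : HomeoPlus) : Monotone (toReal f) :=
  Monotone.IccExtend zero_le_one fun _ _ h => f.2.monotone h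

theorem mapsTo_toReal (f : HomeoPlus) : Set.MapsTo (toReal f) (Set.Icc 0 1) (Set.Icc 0 1) :=
  fun x hx => toReal_coe f ⟨x, hx⟩ ▸ (f.1 ⟨x, hx⟩).2

theorem toReal_inv_toReal (f : HomeoPlus) {x : ℝ} (hx : x ∈ Set.Icc (0 : ℝ) 1) :
    toReal f⁻¹ (toReal f x) = x := by
  lift x to I using hx
  rw [toReal_coe, toReal_coe]
  exact congrArg Subtype.val (f.1.symm_apply_apply x)

namespace IsDiffeoHolder

variable {τ : ℝ}

theorem hasDerivWithinAt_toReal {f : HomeoPlus} (hf : IsDiffeoHolder τ f) {x : ℝ}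
    (hx : x ∈ Set.Icc (0 : ℝ) 1) :
    HasDerivWithinAt (toReal f) (derivWithin (toReal f) (Set.Icc 0 1) x) (Set.Icc 0 1) x :=
  (hf.contDiffOn.differentiableOn one_ne_zero x hx).hasDerivWithinAt

theorem derivWithin_toReal_pos {f : HomeoPlus} (hf : IsDiffeoHolder τ f) {x : ℝ}
    (hx : x ∈ Set.Icc (0 : ℝ) 1) : 0 < derivWithin (toReal f) (Set.Icc 0 1) x := by
  have hinv := hf.contDiffOn_inv.differentiableOn one_ne_zero _ (mapsTo_toReal f hx)
  have hid := (hinv.hasDerivWithinAt.comp x (hf.hasDerivWithinAt_toReal hx)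
    (mapsTo_toReal f)).congr_of_mem (fun y hy => (toReal_inv_toReal f hy).symm) hx
  have hmul := (uniqueDiffOn_Icc zero_lt_one x hx).eq_deriv _ hid (hasDerivWithinAt_id x _)
  exact ((monotone_toReal f).monotoneOn _).derivWithin_nonneg.lt_of_ne'
    (right_ne_zero_of_mul (hmul.trans_ne one_ne_zero))

theorem exists_forall_logRatio_le (hτ : 0 ≤ τ) {f : HomeoPlus} (hf : IsDiffeoHolder τ f) :
    ∃ C : ℝ, ∀ s m t : I, s < m → m < t →
      logRatio (f.1 s) (f.1 m) (f.1 t) ≤ logRatio s m t + C * ((t : ℝ) - s) ^ τ := by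
  obtain ⟨H, hH⟩ := hf.holder
  obtain ⟨z, hz, hmin⟩ := isCompact_Icc.exists_isMinOn (Set.nonempty_Icc.mpr zero_le_one)
    (hf.contDiffOn.continuousOn_derivWithin (uniqueDiffOn_Icc zero_lt_one) le_rfl)
  refine ⟨|H| / derivWithin (toReal f) (Set.Icc 0 1) z, fun s m t hsm hmt => ?_⟩
  simp only [← toReal_coe]
  exact logRatio_map_le_of_holder (fun x => hf.hasDerivWithinAt_toReal)
    (hf.derivWithin_toReal_pos hz) (fun x hx => hmin hx) hτ (abs_nonneg H)
    (fun x hx y hy => (hH x hx y hy).trans (by gcongr; exact le_abs_self H))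
    s.2.1 hsm hmt t.2.2

theorem exists_forall_logRatio_le_of_finite {κ : Type*} [Finite κ] (hτ : 0 ≤ τ)
    {F : κ → HomeoPlus} (hF : ∀ k, IsDiffeoHolder τ (F k)) :
    ∃ C ≥ 0, ∀ k, ∀ s m t : I, s < m → m < t →
      logRatio ((F k).1 s) ((F k).1 m) ((F k).1 t) ≤
        logRatio s m t + C * ((t : ℝ) - s) ^ τ := by
  choose C hC using fun k => (hF k).exists_forall_logRatio_le hτ
  obtain ⟨M, hM⟩ := Finite.exists_le C
  refine ⟨max M 0, le_max_right M 0, fun k s m t hsm hmt => (hC k s m t hsm hmt).trans ?_⟩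
  have hst : (0 : ℝ) ≤ t - s := sub_nonneg.mpr (hsm.trans hmt).le
  gcongr
  exact (hM k).trans (le_max_left M 0)

theorem exists_forall_sub_lt_sub {ι : Type*} [Fintype ι] [Nonempty ι]
    (hτ : 1 / (Fintype.card ι : ℝ) < τ) (hτ_le : τ ≤ 1)
    {E : Multiplicative (ι → ℤ) →* HomeoPlus} (hE : ∀ v, IsDiffeoHolder τ (E v)) {x b : I}
    (hxb : x < b) (hdisj : Pairwise fun v w => (E v).1 b ≤ (E w).1 x ∨ (E w).1 b ≤ (E v).1 x) :
    ∃ κ > 0, ∀ b' : I, b < b' → (b' - b : ℝ) ≤ κ * (b - x) →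
      ∀ v, ((E v).1 b' - (E v).1 b : ℝ) < (E v).1 b - (E v).1 x := by
  classical
  have hτ0 : 0 ≤ τ := le_trans (by positivity) hτ.le
  obtain ⟨S, hS⟩ := exists_forall_sub_lt_sub_of_logRatio_step_le ι hτ hτ_le
  obtain ⟨C, hC0, hC⟩ := exists_forall_logRatio_le_of_finite hτ0
    (F := fun k : ι × ℤˣ => E (.ofAdd (Pi.single k.1 (k.2 : ℤ)))) fun k => hE _
  refine ⟨Real.exp (-(S * C + 1)), Real.exp_pos _, fun b' hbb' hb' v => ?_⟩
  have hxb_map (y : ι → ℤ) : (E (.ofAdd y)).1 x < (E (.ofAdd y)).1 b := (E (.ofAdd y)).2 hxb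
  have hbb'_map (y : ι → ℤ) : (E (.ofAdd y)).1 b < (E (.ofAdd y)).1 b' := (E (.ofAdd y)).2 hbb'
  refine hS C hC0 (fun y => (E (.ofAdd y)).1 x) (fun y => (E (.ofAdd y)).1 b)
    (fun y => (E (.ofAdd y)).1 b') hxb_map hbb'_map (fun F => ?_) (fun y i ε z hz => ?_) 0
    v.toAdd ?_
  · exact (sum_sub_le_of_nonoverlapping zero_le_one (fun y => ((E (.ofAdd y)).1 x).2.1)
      (fun y => ((E (.ofAdd y)).1 b).2.2) (fun y => (hxb_map y).le) hdisj F).trans_eq (sub_zero 1)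
  · rw [hz, add_comm y, ofAdd_add, map_mul]
    exact hC (i, ε) _ _ _ (hxb_map y) (hbb'_map y)
  · have hlog := logRatio_le_log hxb hbb' hb'
    rw [Real.log_exp] at hlog
    simp only [ofAdd_zero, _root_.map_one]
    exact (add_le_add_left hlog _).trans_lt (by linarith)

end IsDiffeoHolder

theorem exists_gt_coe_lt_add (b : Set.Ioo (0 : I) 1) {δ : ℝ} (hδ : 0 < δ) :
    ∃ c : Set.Ioo (0 : I) 1, b < c ∧ ((c : I) : ℝ) < b + δ := by
  obtain ⟨u, hbu, hu⟩ := exists_between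
    (lt_min (lt_add_of_pos_right ((b : I) : ℝ) hδ) (show ((b : I) : ℝ) < 1 from b.2.2))
  have hu0 : 0 < u := lt_trans (show (0 : ℝ) < (b : I) from b.2.1) hbu
  have hu1 : u < 1 := hu.trans_le (min_le_right _ _)
  exact ⟨⟨⟨u, hu0.le, hu1.le⟩, hu0, hu1⟩, hbu, hu.trans_le (min_le_left _ _)⟩

noncomputable instance : Inhabited (Set.Ioo (0 : I) 1) :=
  Classical.inhabited_of_nonempty (Set.nonempty_Ioo.mpr zero_lt_one).to_subtype

theorem exists_smul_lt_of_isDiffeoHolder {ι : Type*} [Fintype ι] [Nonempty ι] {τ : ℝ}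
    (hτ : 1 / (Fintype.card ι : ℝ) < τ) (hτ_le : τ ≤ 1) {Γ : Subgroup HomeoPlus}
    (hΓ : ∀ f ∈ Γ, IsDiffeoHolder τ f) (e : Γ ≃* Multiplicative (ι → ℤ))
    {T : Γ →* Multiplicative ℝ} (hT : IsTranslationNumber (Set.Ioo (0 : I) 1) T)
    (hinj : Function.Injective T) (hdense : DenseRange fun g => (T g).toAdd)
    {x q : Set.Ioo (0 : I) 1} (hxq : x < q) : ∃ g : Γ, 0 < (T g).toAdd ∧ g • x < q := by
  by_contra! hgap
  obtain ⟨b, hxb, hb, hacc⟩ := exists_wandering_interval hdense hxq hgap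
  obtain ⟨κ, hκ, hshort⟩ := IsDiffeoHolder.exists_forall_sub_lt_sub hτ hτ_le
    (E := Γ.subtype.comp e.symm.toMonoidHom) (fun v => hΓ _ (e.symm v).2) hxb fun v w hvw =>
      smul_le_smul_or_smul_le_smul hinj hb (e.symm.injective.ne hvw)
  have hlen : (0 : ℝ) < (b : I) - (x : I) := sub_pos.mpr hxb
  obtain ⟨b', hbb', hb'⟩ := exists_gt_coe_lt_add b (mul_pos hκ hlen)
  have hlen' : (0 : ℝ) < (b' : I) - (b : I) := sub_pos.mpr hbb'
  obtain ⟨r, hbr, hr⟩ := exists_gt_coe_lt_add b (half_pos hlen')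
  obtain ⟨g, hg, hgr⟩ := hacc r hbr
  have hgx : ((b : I) : ℝ) ≤ (g • x : Set.Ioo (0 : I) 1) := hb g hg
  have hgb : (((g • b : Set.Ioo (0 : I) 1) : I) : ℝ) < (r : I) := hgr
  have hgb' : ((b' : I) : ℝ) < (g • b' : Set.Ioo (0 : I) 1) := (hT g b').mpr hg
  have hcompare := hshort b' hbb' (by linarith) (e g)
  simp only [MonoidHom.comp_apply, MulEquiv.coe_toMonoidHom, e.symm_apply_apply] at hcompare
  change (((g • b' : Set.Ioo (0 : I) 1) : I) : ℝ) - (g • b : Set.Ioo (0 : I) 1) <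
    (g • b : Set.Ioo (0 : I) 1) - (g • x : Set.Ioo (0 : I) 1) at hcompare
  linarith

end HomeoPlus

theorem mainTheorem6 (d : ℕ) (hd : 2 ≤ d) (τ : ℝ) (hτ : 1 / (d : ℝ) < τ) (hτ_le : τ ≤ 1)
    (Γ : Subgroup HomeoPlus)
    (hΓ_diff : ∀ f ∈ Γ, HomeoPlus.IsDiffeoHolder τ f)
    (hΓ_iso : Nonempty (Γ ≃* Multiplicative (Fin d → ℤ)))
    (hΓ_free : HomeoPlus.ActsFreely Γ) :
    MulAction.IsMinimal Γ (Set.Ioo (0 : I) 1) ∧ HomeoPlus.ConjugateToTranslations Γ := by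
  obtain ⟨e⟩ := hΓ_iso
  have : Nontrivial (Fin d) := Fin.nontrivial_iff_two_le.mpr hd
  have : IsCancelSMul Γ (Set.Ioo (0 : I) 1) :=
    isCancelSMul_iff_eq_one_of_smul_eq.mpr hΓ_free
  have : IsMulCommutative Γ :=
    ⟨⟨fun g h => e.injective (by rw [map_mul, map_mul, mul_comm])⟩⟩
  have hcyclic : ¬ IsCyclic Γ := fun h =>
    not_isCyclic_multiplicative_int_pi (Fin d) (isCyclic_of_surjective e e.surjective)
  obtain ⟨T, hT⟩ := exists_isTranslationNumber (G := Γ) (X := Set.Ioo (0 : I) 1)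
  have hdense := denseRange_toAdd_of_not_isCyclic hT.injective hcyclic
  have hmin : MulAction.IsMinimal Γ (Set.Ioo (0 : I) 1) := hT.isMinimal fun _ _ =>
    HomeoPlus.exists_smul_lt_of_isDiffeoHolder (by rwa [Fintype.card_fin]) hτ_le hΓ_diff e hT
      hT.injective hdense
  obtain ⟨φ, hφ⟩ := hT.exists_homeomorph hdense
  exact ⟨hmin, φ, T, hφ⟩
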